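/- Let $D=d_1d_2$, where $D$, $d_1$ and $d_2$ are discriminants of quadratic number fields, and suppose that the Kronecker symbol $\left(\frac{d_2}{p}\right)$ equals $1$ for every prime $p\mid d_1$ and that $\left(\frac{d_1}{p}\right)$ equals $1$ for every prime $p\mid d_2$. Let $x,y,z$ be integers with $\gcd(x,y,z)=1$ and $x^2-d_1y^2-d_2z^2=0$. Then there exists $t\in\{\pm1,\pm2\}$ such that the field $$F_t=\mathbf{Q}\left(\sqrt{d_1},\sqrt{d_2},\sqrt{tx+ty\sqrt{d_1}}\right)$$ is a cyclic extension of $\mathbf{Q}(\sqrt D)$ of degree $4$ that is unramified at all finite primes. -/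

import Mathlib

/-- `D` is a quadratic discriminant: the discriminant of the quadratic field `ℚ(√d)` for a
squarefree integer `d ≠ 1`, that is, `d` if `d ≡ 1 mod 4` and `4d` otherwise. -/
def IsQuadraticDiscriminant (D : ℤ) : Prop :=
  ∃ d : ℤ, Squarefree d ∧ d ≠ 1 ∧ D = if d % 4 = 1 then d else 4 * d

/-- A discriminantal decomposition: a quadratic discriminant `D` written as the product of two
quadratic discriminants. -/
structure IsDiscriminantalDecomposition (D d₁ d₂ : ℤ) : Prop where
  isDiscr : IsQuadraticDiscriminant D
  isDiscr₁ : IsQuadraticDiscriminant d₁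
  isDiscr₂ : IsQuadraticDiscriminant d₂
  eq_mul : D = d₁ * d₂

/-- The Kronecker symbol `(a / p)` for a prime `p`: the Legendre symbol for odd `p`; for `p = 2` it
is `0` if `a` is even, `1` if `a ≡ ±1 mod 8` and `-1` if `a ≡ ±3 mod 8`. -/
def kroneckerAtPrime (a : ℤ) (p : ℕ) [Fact p.Prime] : ℤ :=
  if p = 2 then ZMod.χ₈ (a : ZMod 8) else legendreSym p a

/-- A discriminantal decomposition `D = d₁d₂` such that, for every prime `p` dividing one of the
two factors, the Kronecker symbol of the other factor at `p` equals `1`. -/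
structure SatisfiesRedeiConditions (D d₁ d₂ : ℤ) : Prop
    extends IsDiscriminantalDecomposition D d₁ d₂ where
  symbol₁ : ∀ (p : ℕ) [Fact p.Prime], (p : ℤ) ∣ d₁ → kroneckerAtPrime d₂ p = 1
  symbol₂ : ∀ (p : ℕ) [Fact p.Prime], (p : ℤ) ∣ d₂ → kroneckerAtPrime d₁ p = 1

/-- The extension `L / K` is unramified at all finite primes: `𝓞 L` is unramified over `𝓞 K` at
every nonzero prime ideal of `𝓞 L`. No condition is imposed at the infinite primes. -/
def IsFinitelyUnramified (K L : Type*) [Field K] [Field L] [Algebra K L] : Prop :=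
  ∀ (P : Ideal (NumberField.RingOfIntegers L)) [P.IsPrime], P ≠ ⊥ →
    Algebra.IsUnramifiedAt (NumberField.RingOfIntegers K) P

/-- `L / K` is a Galois extension of degree `4` with cyclic Galois group. -/
structure IsCyclicQuartic (K L : Type*) [Field K] [Field L] [Algebra K L] : Prop where
  isGalois : IsGalois K L
  isCyclic : IsCyclic (L ≃ₐ[K] L)
  finrank_eq : Module.finrank K L = 4

/-! Put K = ℚ(√D), s₁ = √d₁, s₂ = √d₂ and s = √(t(x + y s₁)). The equation says that t(x + y s₁) and
its conjugate have product (tz)²d₂, so s' = tzs₂/s is a square root of the conjugate. Hence F_t/K is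
Galois. Since s₁s₂ ∈ K, an automorphism τ moving s₁ also negates s₂; it sends s to ±s', and so τ²(s)
= -s. The group is therefore cyclic of order 4 (`isCyclicQuartic`), with one involution c, which
negates s and s'.

Every nontrivial subgroup contains c, so it suffices to find, for each prime P, an integer a with
c(a) - a ∉ P. Above an odd p, s or s' serves: otherwise p divides x and y²d₁, against primitivity
and the absence of p² in d₁ and d₂ (`not_dvd_of_dvd_sq_mul`). Above 2, one takes a = (m + w)/2 with
w² ≡ m² mod 4, c(w) = -w and m ∉ P; the twist t makes this possible (`exists_isTwoAdicTwist`).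

The twist is found either for d₁ or for d₂. The second case is reduced to the first by 2(x + y s₁)(x
+ z s₂) = (x + y s₁ + z s₂)², which exchanges d₁ and d₂ at the price of a factor 2 in t. -/

/-- A Galois extension of number fields is unramified at all finite primes as soon as no
nontrivial automorphism lies in an inertia group. -/
theorem isFinitelyUnramified_of_inertia {K L : Type*} [Field K] [Field L] [NumberField K]
    [NumberField L] [Algebra K L] [IsGalois K L]
    (h : ∀ (P : Ideal (NumberField.RingOfIntegers L)) [P.IsPrime], P ≠ ⊥ →
      ∀ g : L ≃ₐ[K] L, g ≠ 1 → ∃ a : NumberField.RingOfIntegers L, g • a - a ∉ P) :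
    IsFinitelyUnramified K L := by
  intro P _ hP
  have hp : P.under (NumberField.RingOfIntegers K) ≠ ⊥ :=
    mt Ideal.eq_bot_of_comap_eq_bot hP
  have : (P.under (NumberField.RingOfIntegers K)).IsMaximal :=
    Ideal.IsPrime.isMaximal inferInstance hp
  have : Finite (NumberField.RingOfIntegers K ⧸ P.under (NumberField.RingOfIntegers K)) :=
    Ideal.finiteQuotientOfFreeOfNeBot _ hp
  have : Finite (P.under (NumberField.RingOfIntegers K)).ResidueField := by
    refine Finite.of_surjective
      (algebraMap (NumberField.RingOfIntegers K ⧸ P.under (NumberField.RingOfIntegers K)) _)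
      (Ideal.bijective_algebraMap_quotient_residueField _).2
  -- The inertia group has order equal to the ramification index.
  have hcard := Ideal.card_inertia_eq_ramificationIdxIn (G := L ≃ₐ[K] L)
    (P.under (NumberField.RingOfIntegers K)) P
  rw [Ideal.ramificationIdxIn_eq_ramificationIdx _ P (L ≃ₐ[K] L)] at hcard
  have hbot : P.inertia (L ≃ₐ[K] L) = ⊥ := by
    rw [eq_bot_iff]
    intro g hg
    by_contra hne
    obtain ⟨a, ha⟩ := h P hP g hne
    exact ha (hg a)
  rw [hbot, Subgroup.card_bot] at hcard
  exact Ideal.ramificationIdx_eq_one_iff.mp hcard.symm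

/-! ### Primes above 2: integral elements moved by the involution -/

/-- (u + w)/2 is a root of X² - uX - e. -/
theorem exists_two_mul_eq_add {R : Type*} [CommRing R] [IsDomain R] [CharZero R]
    [IsIntegrallyClosed R] {u w e : R} (h : w ^ 2 = u ^ 2 + 4 * e) : ∃ a : R, 2 * a = u + w := by
  have h2 : (2 : FractionRing R) ≠ 0 := two_ne_zero
  set f := algebraMap R (FractionRing R) with hf
  have hint : IsIntegral R ((f u + f w) / 2) := by
    refine ⟨Polynomial.X ^ 2 - Polynomial.C u * Polynomial.X - Polynomial.C e, ?_, ?_⟩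
    · monicity!
    · have h' : f w ^ 2 = f u ^ 2 + 4 * f e := by
        have := congrArg f h
        rwa [map_add, map_mul, map_pow, map_pow, map_ofNat] at this
      simp only [Polynomial.eval₂_sub, Polynomial.eval₂_mul, Polynomial.eval₂_pow,
        Polynomial.eval₂_X, Polynomial.eval₂_C, ← hf]
      field_simp
      linear_combination h'
  obtain ⟨a, ha⟩ := IsIntegrallyClosed.isIntegral_iff.mp hint
  refine ⟨a, IsFractionRing.injective R (FractionRing R) ?_⟩
  rw [map_mul, map_add, ha, map_ofNat]
  field_simp
  rfl

section

variable {R : Type*} [CommRing R] [IsDomain R] [CharZero R] [IsIntegrallyClosed R]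

/-- For a = (m + w)/2 one has c(a) - a = -w, and w ∈ P would force m² ∈ P. -/
theorem exists_sub_notMem_of_sq_eq (c : R →+* R) (P : Ideal R) [P.IsPrime] (h2 : (2 : R) ∈ P)
    {m w e : R} (hw : w ^ 2 = m ^ 2 + 4 * e) (hm : m ∉ P) (hcw : c w = -w) (hcm : c m = m) :
    ∃ a, c a - a ∉ P := by
  obtain ⟨a, ha⟩ := exists_two_mul_eq_add hw
  have hca : 2 * c a = m - w := by
    have := congrArg c ha
    rw [map_mul, map_ofNat, map_add, hcw, hcm] at this
    linear_combination this
  have hsub : c a - a = -w := mul_left_cancel₀ (two_ne_zero' R) (by linear_combination hca - ha)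
  refine ⟨a, fun hmem ↦ hm ?_⟩
  rw [hsub, neg_mem_iff] at hmem
  refine Ideal.IsPrime.mem_of_pow_mem inferInstance 2 ?_
  rw [show m ^ 2 = w * w - 2 * (2 * e) by linear_combination -hw]
  exact sub_mem (P.mul_mem_left _ hmem) (P.mul_mem_right _ h2)

/-- With ω = (1 + S₁)/2, S² = t(x - 2y) + 4tyω is 1 mod 4, so m = 1 works. -/
theorem exists_sub_notMem_of_sq_eq_one_add (c : R →+* R) (P : Ideal R) [P.IsPrime]
    (h2 : (2 : R) ∈ P) {d x y t f g : ℤ} {S₁ S : R} (hS₁ : S₁ ^ 2 = d)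
    (hS : S ^ 2 = t * (x + 2 * y * S₁)) (hc : c S = -S) (hd : d = 4 * f + 1)
    (hg : t * (x - 2 * y) = 4 * g + 1) : ∃ a, c a - a ∉ P := by
  obtain ⟨ω, hω⟩ := exists_two_mul_eq_add (R := R) (u := 1) (w := S₁) (e := f)
    (by rw [hS₁, hd]; push_cast; ring)
  have hg' : (t : R) * (x - 2 * y) = 4 * g + 1 := by exact_mod_cast congrArg (Int.cast (R := R)) hg
  exact exists_sub_notMem_of_sq_eq c P h2 (m := 1) (w := S) (e := g + t * y * ω)
    (by linear_combination hS + hg' - 2 * t * y * hω) (Ideal.one_notMem P) hc (map_one c)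

/-- The integer r approximates √d 2-adically. Since m(m - r) is divisible by 2·4^j, m²S² agrees with
m²t(x + yr) modulo 4·4^j. So w = mS/2^j is integral and w² ≡ m² mod 4. -/
theorem exists_sub_notMem_of_half_notMem (c : R →+* R) (P : Ideal R) [P.IsPrime]
    (h2 : (2 : R) ∈ P) {x y t r h g : ℤ} {j : ℕ} {S₁ S m : R}
    (hS₁ : S₁ ^ 2 = r ^ 2 + 8 * 4 ^ j * h)
    (hS : S ^ 2 = t * (x + y * S₁)) (hc₁ : c S₁ = S₁) (hc : c S = -S)
    (hg : t * (x + y * r) = 4 ^ j * (4 * g + 1)) (hm : 2 * m = r + S₁) (hmP : m ∉ P) :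
    ∃ a, c a - a ∉ P := by
  have hg' : (t : R) * (x + y * r) = 4 ^ j * (4 * g + 1) := by
    exact_mod_cast congrArg (Int.cast (R := R)) hg
  have h4 : (4 : R) ^ j = (2 ^ j) ^ 2 := by rw [← pow_mul, mul_comm, pow_mul]; norm_num
  have hmm : m * (m - r) = 2 * 4 ^ j * h :=
    mul_left_cancel₀ (by norm_num : (4 : R) ≠ 0) (by
      linear_combination hS₁ + (2 * m - r + S₁) * hm)
  have hsq : (m * S) ^ 2 = (2 ^ j) ^ 2 * (m ^ 2 + 4 * (g * m ^ 2 + y * t * h * m)) := by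
    rw [← h4]
    linear_combination m ^ 2 * hS + m ^ 2 * hg' + 2 * t * y * m * hmm - m ^ 2 * t * y * hm
  obtain ⟨w, hw⟩ := (IsIntegrallyClosed.pow_dvd_pow_iff two_ne_zero).mp ⟨_, hsq⟩
  have hpow : (2 : R) ^ j ≠ 0 := pow_ne_zero _ two_ne_zero
  have hcm : c m = m := mul_left_cancel₀ (two_ne_zero' R) (by
    have := congrArg c hm
    rw [map_mul, map_ofNat, map_add, hc₁, map_intCast] at this
    rw [this, hm])
  refine exists_sub_notMem_of_sq_eq c P h2 (m := m) (w := w)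
    (e := g * m ^ 2 + y * t * h * m) ?_ hmP ?_ hcm
  · refine mul_left_cancel₀ (pow_ne_zero 2 hpow) ?_
    rw [← hsq, hw, mul_pow]
  · refine mul_left_cancel₀ hpow ?_
    have := congrArg c hw
    rw [map_mul, map_mul, hc, hcm, map_pow, map_ofNat] at this
    linear_combination -this + (-1 : R) * hw

theorem exists_sub_notMem_of_sq_eq_four_pow (c : R →+* R) (P : Ideal R) [P.IsPrime]
    (h2 : (2 : R) ∈ P) {d x y t r h g : ℤ} {j : ℕ} {S₁ S S' : R}
    (hS₁ : S₁ ^ 2 = d) (hS : S ^ 2 = t * (x + y * S₁)) (hS' : S' ^ 2 = t * (x - y * S₁))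
    (hc₁ : c S₁ = S₁) (hc : c S = -S) (hc' : c S' = -S')
    (hr : Odd r) (hd : d = r ^ 2 + 8 * 4 ^ j * h)
    (hg : t * (x + y * r) = 4 ^ j * (4 * g + 1)) : ∃ a, c a - a ∉ P := by
  have hsq : S₁ ^ 2 = (r : R) ^ 2 + 8 * 4 ^ j * h := by
    rw [hS₁, hd]; push_cast; ring
  obtain ⟨m, hm⟩ := exists_two_mul_eq_add (R := R) (u := r) (w := S₁) (e := 2 * 4 ^ j * h)
    (by rw [hsq]; ring)
  by_cases hmP : m ∈ P
  -- (r + S₁)/2 and (r - S₁)/2 have odd sum r, so one lies outside P. If it is the second, S₁ ↦ -S₁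
  -- and S ↦ S' reduce to the first.
  · refine exists_sub_notMem_of_half_notMem c P h2 (x := x) (y := y) (S₁ := -S₁) (S := S')
      (m := r - m) (by rw [neg_sq, hsq]) (by rw [hS']; ring) (by rw [map_neg, hc₁]) hc' hg
      (by linear_combination -hm) ?_
    intro hmem
    obtain ⟨k, hk⟩ := hr
    have hrP : (r : R) ∈ P := by simpa using add_mem hmem hmP
    refine Ideal.one_notMem P ?_
    rw [show (1 : R) = r - 2 * k by rw [hk]; push_cast; ring]
    exact sub_mem hrP (P.mul_mem_right _ h2)
  · exact exists_sub_notMem_of_half_notMem c P h2 hsq hS hc₁ hc hg hm hmP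

end

/-! ### Quadratic discriminants and the Rédei conditions -/

namespace IsQuadraticDiscriminant

variable {D : ℤ}

theorem not_isSquare (h : IsQuadraticDiscriminant D) : ¬ IsSquare D := by
  obtain ⟨d, hsf, hne, rfl⟩ := h
  have key : ¬ IsSquare d := by
    rintro ⟨n, rfl⟩
    have hn : IsUnit n := hsf n dvd_rfl
    rcases Int.isUnit_iff.mp hn with rfl | rfl <;> exact hne rfl
  split_ifs
  · exact key
  · rintro ⟨n, hn⟩
    have h2 : (2 : ℤ) ∣ n := by
      have : (2 : ℤ) ∣ n * n := ⟨2 * d, by rw [← hn]; ring⟩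
      exact (Int.prime_two.dvd_or_dvd this).elim id id
    obtain ⟨k, rfl⟩ := h2
    exact key ⟨k, by linarith⟩

theorem ne_zero (h : IsQuadraticDiscriminant D) : D ≠ 0 := by
  rintro rfl
  exact h.not_isSquare (IsSquare.zero)

theorem sq_ne_ratCast (h : IsQuadraticDiscriminant D) (q : ℚ) : q ^ 2 ≠ D := by
  intro hq
  exact h.not_isSquare (Rat.isSquare_intCast_iff.mp ⟨q, by rw [← hq, sq]⟩)

theorem emod_four_eq_one_or_four_dvd (h : IsQuadraticDiscriminant D) : D % 4 = 1 ∨ 4 ∣ D := by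
  obtain ⟨d, -, -, rfl⟩ := h
  split_ifs with h
  · exact Or.inl h
  · exact Or.inr (dvd_mul_right _ _)

theorem not_sq_dvd (h : IsQuadraticDiscriminant D) {p : ℕ} (hp : p.Prime) (hp2 : p ≠ 2) :
    ¬ (p : ℤ) ^ 2 ∣ D := by
  obtain ⟨d, hsf, -, rfl⟩ := h
  have hpi : Prime (p : ℤ) := Nat.prime_iff_prime_int.mp hp
  have key : ¬ (p : ℤ) ^ 2 ∣ d := fun h ↦ hpi.not_isUnit (hsf _ (by rwa [← sq]))
  split_ifs
  · exact key
  · intro h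
    refine key (IsCoprime.dvd_of_dvd_mul_left ?_ h)
    have h2 : IsCoprime (p : ℤ) 2 := by
      have := (Nat.coprime_primes hp Nat.prime_two).mpr hp2
      exact_mod_cast Nat.isCoprime_iff_coprime.mpr this
    rw [show (4 : ℤ) = 2 ^ 2 by norm_num]
    exact h2.pow

end IsQuadraticDiscriminant

theorem kroneckerAtPrime_eq_zero_of_dvd {a : ℤ} {p : ℕ} [Fact p.Prime] (h : (p : ℤ) ∣ a) :
    kroneckerAtPrime a p = 0 := by
  unfold kroneckerAtPrime
  split_ifs with hp
  · subst hp
    rw [ZMod.χ₈_int_eq_if_mod_eight, if_pos]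
    exact_mod_cast Int.emod_eq_zero_of_dvd h
  · exact (legendreSym.eq_zero_iff p a).mpr ((ZMod.intCast_zmod_eq_zero_iff_dvd a p).mpr h)

namespace SatisfiesRedeiConditions

variable {D d₁ d₂ : ℤ}

theorem symm (h : SatisfiesRedeiConditions D d₁ d₂) : SatisfiesRedeiConditions D d₂ d₁ where
  isDiscr := h.isDiscr
  isDiscr₁ := h.isDiscr₂
  isDiscr₂ := h.isDiscr₁
  eq_mul := by rw [h.eq_mul, mul_comm]
  symbol₁ := h.symbol₂
  symbol₂ := h.symbol₁

theorem not_dvd (h : SatisfiesRedeiConditions D d₁ d₂) {p : ℕ} (hp : p.Prime)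
    (h₁ : (p : ℤ) ∣ d₁) : ¬ (p : ℤ) ∣ d₂ := by
  intro h₂
  have : Fact p.Prime := ⟨hp⟩
  have := h.symbol₁ p h₁
  rw [kroneckerAtPrime_eq_zero_of_dvd h₂] at this
  exact zero_ne_one this

theorem emod_eight_eq_one (h : SatisfiesRedeiConditions D d₁ d₂) (h₂ : (2 : ℤ) ∣ d₂) :
    d₁ % 8 = 1 := by
  have hs := h.symbol₂ 2 (by exact_mod_cast h₂)
  have h4 := h.isDiscr₁.emod_four_eq_one_or_four_dvd
  rw [kroneckerAtPrime, if_pos rfl, ZMod.χ₈_int_eq_if_mod_eight] at hs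
  split_ifs at hs <;> omega

/-- If p divides y, then p ∤ z and p² ∣ d₂. Otherwise p divides d₁, hence not d₂, hence z, and p² ∣
d₁. -/
theorem not_dvd_of_dvd_sq_mul (h : SatisfiesRedeiConditions D d₁ d₂) {x y z : ℤ}
    (hprim : Int.gcd (Int.gcd x y) z = 1) (hsol : x ^ 2 - d₁ * y ^ 2 - d₂ * z ^ 2 = 0)
    {p : ℕ} (hp : p.Prime) (hp2 : p ≠ 2) (hx : (p : ℤ) ∣ x) : ¬ (p : ℤ) ∣ y ^ 2 * d₁ := by
  intro hy
  have hpi : Prime (p : ℤ) := Nat.prime_iff_prime_int.mp hp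
  have hprim' : (p : ℤ) ∣ y → ¬ (p : ℤ) ∣ z := by
    intro hy hz
    have := Int.dvd_coe_gcd (Int.dvd_coe_gcd hx hy) hz
    rw [hprim] at this
    exact hpi.not_isUnit (isUnit_of_dvd_one (by exact_mod_cast this))
  have hx2 := pow_dvd_pow_of_dvd hx 2
  by_cases hpy : (p : ℤ) ∣ y
  · have hdvd : (p : ℤ) ^ 2 ∣ d₂ * z ^ 2 := by
      rw [show d₂ * z ^ 2 = x ^ 2 - d₁ * y ^ 2 by linarith]
      exact dvd_sub hx2 ((pow_dvd_pow_of_dvd hpy 2).mul_left _)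
    have hcop : IsCoprime ((p : ℤ) ^ 2) (z ^ 2) :=
      ((Prime.coprime_iff_not_dvd hpi).mpr (hprim' hpy)).pow
    exact h.isDiscr₂.not_sq_dvd hp hp2 (hcop.dvd_of_dvd_mul_right hdvd)
  · have hd₁ : (p : ℤ) ∣ d₁ :=
      (hpi.dvd_or_dvd hy).resolve_left fun h ↦ hpy (hpi.dvd_of_dvd_pow h)
    have hd₂ := h.not_dvd hp hd₁
    have hz : (p : ℤ) ∣ z := by
      have : (p : ℤ) ∣ d₂ * z ^ 2 := by
        rw [show d₂ * z ^ 2 = x ^ 2 - d₁ * y ^ 2 by linarith]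
        exact dvd_sub (hx.trans (dvd_pow_self _ two_ne_zero)) (hd₁.mul_right _)
      exact hpi.dvd_of_dvd_pow ((hpi.dvd_or_dvd this).resolve_left hd₂)
    have hdvd : (p : ℤ) ^ 2 ∣ d₁ * y ^ 2 := by
      rw [show d₁ * y ^ 2 = x ^ 2 - d₂ * z ^ 2 by linarith]
      exact dvd_sub hx2 ((pow_dvd_pow_of_dvd hz 2).mul_left _)
    have hcop : IsCoprime ((p : ℤ) ^ 2) (y ^ 2) :=
      ((Prime.coprime_iff_not_dvd hpi).mpr hpy).pow
    exact h.isDiscr₁.not_sq_dvd hp hp2 (hcop.dvd_of_dvd_mul_right hdvd)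

/-- With z = 0, either d₁ would be a rational square or x = y = 0. -/
theorem ne_zero_of_sol (h : SatisfiesRedeiConditions D d₁ d₂) {x y z : ℤ}
    (hprim : Int.gcd (Int.gcd x y) z = 1) (hsol : x ^ 2 - d₁ * y ^ 2 - d₂ * z ^ 2 = 0) :
    z ≠ 0 := by
  rintro rfl
  have hy : y = 0 := by
    by_contra hy
    refine h.isDiscr₁.sq_ne_ratCast (x / y) ?_
    have hy' : (y : ℚ) ≠ 0 := by exact_mod_cast hy
    rw [div_pow, div_eq_iff (pow_ne_zero 2 hy')]
    exact_mod_cast (by linarith : x ^ 2 = d₁ * y ^ 2)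
  subst hy
  have hx : x = 0 := by
    refine pow_eq_zero_iff two_ne_zero |>.mp (?_ : x ^ 2 = 0)
    linarith
  subst hx
  simp at hprim

end SatisfiesRedeiConditions

/-! ### Choice of the twist at 2 -/

/-- The condition on a twist `t` that makes `√(t (x + y √d))` generate an extension of
`ℚ(√d, √(x² - d y²))` that is unramified at the primes above `2`. -/
def IsTwoAdicTwist (d x y t : ℤ) : Prop :=
  (∃ k f g : ℤ, y = 2 * k ∧ d = 4 * f + 1 ∧ t * (x - 2 * k) = 4 * g + 1) ∨
  ∃ (r h g : ℤ) (j : ℕ), Odd r ∧ d = r ^ 2 + 8 * 4 ^ j * h ∧ t * (x + y * r) = 4 ^ j * (4 * g + 1)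

theorem exists_odd_sq_modEq {d : ℤ} (hd : d % 8 = 1) (n : ℕ) :
    ∃ r : ℤ, Odd r ∧ 2 ^ (n + 3) ∣ d - r ^ 2 := by
  induction n with
  | zero => exact ⟨1, odd_one, by norm_num; omega⟩
  | succ n ih =>
    obtain ⟨r, hr, k, hk⟩ := ih
    rcases Int.even_or_odd k with ⟨l, rfl⟩ | ⟨l, rfl⟩
    · exact ⟨r, hr, l, by rw [hk]; ring⟩
    · obtain ⟨q, rfl⟩ := hr
      -- Hensel step: adding 2^(n+2) to the odd r changes r² by an odd multiple of 2^(n+3).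
      refine ⟨2 * q + 1 + 2 ^ (n + 2), ?_, l - q - 2 ^ n, ?_⟩
      · exact ⟨q + 2 ^ (n + 1), by ring⟩
      · linear_combination hk

theorem exists_isTwoAdicTwist_of_emod_eight {d x y m : ℤ} (hd : d % 8 = 1) (hm : m ≠ 0)
    (hsol : x ^ 2 - d * y ^ 2 = m) :
    ∃ t : ℤ, t ∈ ({1, -1, 2, -2} : Set ℤ) ∧ IsTwoAdicTwist d x y t := by
  obtain ⟨M, hM⟩ : ∃ M : ℕ, ¬ (2 : ℤ) ^ M ∣ m := by
    have : FiniteMultiplicity (2 : ℤ) m := Int.finiteMultiplicity_iff.mpr ⟨by norm_num, hm⟩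
    exact ⟨_, this.not_pow_dvd_of_multiplicity_lt (Nat.lt_succ_self _)⟩
  -- Precision 2^(M+4) forces v₂(x + yr) < M, and leaves room for the factor 8·4^j with 2j ≤ v₂(x +
  -- yr) + 1.
  obtain ⟨r, hr, hdr⟩ := exists_odd_sq_modEq hd (M + 1)
  have hb : ¬ (2 : ℤ) ^ M ∣ x + y * r := by
    intro hdvd
    refine hM ?_
    rw [show m = (x + y * r) * (x - y * r) - y ^ 2 * (d - r ^ 2) by rw [← hsol]; ring]
    exact dvd_sub (hdvd.mul_right _)
      (((pow_dvd_pow 2 (by omega)).trans hdr).mul_left _)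
  have hb0 : x + y * r ≠ 0 := fun h ↦ hb (h ▸ dvd_zero _)
  have hfin : FiniteMultiplicity (2 : ℤ) (x + y * r) :=
    Int.finiteMultiplicity_iff.mpr ⟨by norm_num, hb0⟩
  obtain ⟨b, hbv, hbodd⟩ := hfin.exists_eq_pow_mul_and_not_dvd
  set v := multiplicity (2 : ℤ) (x + y * r)
  have hvM : v < M := by
    by_contra hle
    exact hb (hbv ▸ (pow_dvd_pow 2 (not_lt.mp hle)).mul_right _)
  have hsign : ∃ e g : ℤ, (e = 1 ∨ e = -1) ∧ e * b = 4 * g + 1 := by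
    rcases (by omega : b % 4 = 1 ∨ b % 4 = 3) with h | h
    · exact ⟨1, b / 4, Or.inl rfl, by omega⟩
    · exact ⟨-1, -(b / 4) - 1, Or.inr rfl, by omega⟩
  obtain ⟨e, g, he, heb⟩ := hsign
  have hpow (j : ℕ) (hj : 2 * j ≤ M + 1) : ∃ h : ℤ, d = r ^ 2 + 8 * 4 ^ j * h := by
    obtain ⟨h, hh⟩ := (pow_dvd_pow (2 : ℤ) (by omega : 2 * j + 3 ≤ M + 1 + 3)).trans hdr
    refine ⟨h, ?_⟩
    rw [pow_add, pow_mul] at hh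
    norm_num at hh
    linear_combination hh
  -- The sign of t makes the odd part 1 mod 4; a factor 2 in t makes the valuation even.
  rcases Nat.even_or_odd' v with ⟨i, hi | hi⟩
  · obtain ⟨h, hh⟩ := hpow i (by omega)
    refine ⟨e, by rcases he with rfl | rfl <;> simp, Or.inr ⟨r, h, g, i, hr, hh, ?_⟩⟩
    rw [hbv, hi, pow_mul, ← heb]
    norm_num
    ring
  · obtain ⟨h, hh⟩ := hpow (i + 1) (by omega)
    refine ⟨2 * e, by rcases he with rfl | rfl <;> simp, Or.inr ⟨r, h, g, i + 1, hr, hh, ?_⟩⟩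
    rw [hbv, hi, pow_add, pow_mul, pow_succ, ← heb]
    norm_num
    ring

theorem exists_isTwoAdicTwist_of_even {d x y : ℤ} (hd : d % 4 = 1) (hx : Odd x) (hy : Even y) :
    ∃ t : ℤ, t ∈ ({1, -1, 2, -2} : Set ℤ) ∧ IsTwoAdicTwist d x y t := by
  obtain ⟨k, hk⟩ := hy
  obtain ⟨q, rfl⟩ := hx
  rcases (by omega : (2 * q + 1 - 2 * k) % 4 = 1 ∨ (2 * q + 1 - 2 * k) % 4 = 3) with h | h
  · exact ⟨1, by simp, Or.inl ⟨k, d / 4, (2 * q + 1 - 2 * k) / 4, by omega, by omega, by omega⟩⟩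
  · exact ⟨-1, by simp, Or.inl ⟨k, d / 4, -((2 * q + 1 - 2 * k) / 4) - 1, by omega, by omega,
      by omega⟩⟩

theorem SatisfiesRedeiConditions.exists_isTwoAdicTwist {D d₁ d₂ : ℤ}
    (h : SatisfiesRedeiConditions D d₁ d₂) {x y z : ℤ}
    (hprim : Int.gcd (Int.gcd x y) z = 1) (hsol : x ^ 2 - d₁ * y ^ 2 - d₂ * z ^ 2 = 0) :
    ∃ t : ℤ, t ∈ ({1, -1, 2, -2} : Set ℤ) ∧
      (IsTwoAdicTwist d₁ x y t ∨ IsTwoAdicTwist d₂ x z t) := by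
  have hz := h.ne_zero_of_sol hprim hsol
  have hy := h.symm.ne_zero_of_sol (z := y) (y := z) (x := x)
    (by rw [Int.gcd_assoc, Int.gcd_comm z y, ← Int.gcd_assoc]; exact hprim) (by linarith)
  by_cases h₂ : (2 : ℤ) ∣ d₂
  · obtain ⟨t, ht, ht'⟩ := exists_isTwoAdicTwist_of_emod_eight (h.emod_eight_eq_one h₂)
      (mul_ne_zero h.isDiscr₂.ne_zero (pow_ne_zero 2 hz)) (x := x) (y := y) (by linarith)
    exact ⟨t, ht, Or.inl ht'⟩
  by_cases h₁ : (2 : ℤ) ∣ d₁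
  · obtain ⟨t, ht, ht'⟩ := exists_isTwoAdicTwist_of_emod_eight (h.symm.emod_eight_eq_one h₁)
      (mul_ne_zero h.isDiscr₁.ne_zero (pow_ne_zero 2 hy)) (x := x) (y := z) (by linarith)
    exact ⟨t, ht, Or.inr ht'⟩
  have hd₁ : d₁ % 4 = 1 := by
    have := h.isDiscr₁.emod_four_eq_one_or_four_dvd; omega
  have hd₂ : d₂ % 4 = 1 := by
    have := h.isDiscr₂.emod_four_eq_one_or_four_dvd; omega
  have hmod : (x ^ 2 - y ^ 2 - z ^ 2) % 4 = 0 := by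
    obtain ⟨f₁, hf₁⟩ : ∃ f, d₁ = 4 * f + 1 := ⟨d₁ / 4, by omega⟩
    obtain ⟨f₂, hf₂⟩ : ∃ f, d₂ = 4 * f + 1 := ⟨d₂ / 4, by omega⟩
    refine Int.emod_eq_zero_of_dvd ⟨f₁ * y ^ 2 + f₂ * z ^ 2, ?_⟩
    rw [hf₁, hf₂] at hsol
    linarith
  have hnot : ¬ (Even x ∧ Even y ∧ Even z) := by
    rintro ⟨hx, hy, hz⟩
    have := Int.dvd_coe_gcd (Int.dvd_coe_gcd hx.two_dvd hy.two_dvd) hz.two_dvd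
    rw [hprim] at this
    norm_num at this
  have hsq (n : ℤ) : (Even n ∧ n ^ 2 % 4 = 0) ∨ (Odd n ∧ n ^ 2 % 4 = 1) := by
    rcases Int.even_or_odd n with hn | hn
    · exact Or.inl ⟨hn, by obtain ⟨k, rfl⟩ := hn; ring_nf; omega⟩
    · exact Or.inr ⟨hn, by obtain ⟨k, rfl⟩ := hn; ring_nf; omega⟩
  -- As x² ≡ y² + z² mod 4 and not all three are even, x is odd and exactly one of y, z is even.
  rcases hsq x with ⟨hx, hx'⟩ | ⟨hx, hx'⟩ <;> rcases hsq y with ⟨hy, hy'⟩ | ⟨hy, hy'⟩ <;>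
    rcases hsq z with ⟨hz, hz'⟩ | ⟨hz, hz'⟩ <;> try omega
  · exact absurd ⟨hx, hy, hz⟩ hnot
  · obtain ⟨t, ht, ht'⟩ := exists_isTwoAdicTwist_of_even hd₁ hx hy
    exact ⟨t, ht, Or.inl ht'⟩
  · obtain ⟨t, ht, ht'⟩ := exists_isTwoAdicTwist_of_even hd₂ hx hz
    exact ⟨t, ht, Or.inr ht'⟩

/-! ### The Galois group of the quartic extension -/

/-- `L = K(s₁, s₂, s)` with `s₁ ∉ K`, `s₁ s₂ ∈ K`, `s₁² = d₁`, `s₂² = d₂` and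
`s² = t (x + y s₁)`, where `x² - d₁ y² = d₂ z²`. -/
structure IsRedeiExtension (K : Type*) {L : Type*} [Field K] [Field L] [Algebra K L]
    (d₁ d₂ x y z t : ℤ) (s₁ s₂ s : L) : Prop where
  sq₁ : s₁ ^ 2 = d₁
  sq₂ : s₂ ^ 2 = d₂
  sq : s ^ 2 = t * (x + y * s₁)
  exists_mul : ∃ k : K, algebraMap K L k = s₁ * s₂
  notMem : ∀ k : K, algebraMap K L k ≠ s₁
  adjoin_eq_top : IntermediateField.adjoin K {s₁, s₂, s} = ⊤
  sol : x ^ 2 - d₁ * y ^ 2 - d₂ * z ^ 2 = 0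
  twist_ne_zero : t ≠ 0
  ne_zero : z ≠ 0
  ne_zero₂ : d₂ ≠ 0

namespace IsRedeiExtension

variable {K L : Type*} [Field K] [Field L] [Algebra K L]
  {d₁ d₂ x y z t : ℤ} {s₁ s₂ s : L}

section

variable (H : IsRedeiExtension K d₁ d₂ x y z t s₁ s₂ s)
include H

theorem s₁_ne_zero : s₁ ≠ 0 := fun h ↦ H.notMem 0 (by rw [h, map_zero])

theorem apply_s₁ (g : L ≃ₐ[K] L) : g s₁ = s₁ ∨ g s₁ = -s₁ :=
  sq_eq_sq_iff_eq_or_eq_neg.mp (by rw [← map_pow, H.sq₁, map_intCast])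

theorem apply_mul (g : L ≃ₐ[K] L) : g s₁ * g s₂ = s₁ * s₂ := by
  obtain ⟨k, hk⟩ := H.exists_mul
  rw [← map_mul, ← hk, g.commutes]

theorem apply_s₂_of_fix {g : L ≃ₐ[K] L} (hg : g s₁ = s₁) : g s₂ = s₂ := by
  have := H.apply_mul g
  rw [hg] at this
  exact mul_left_cancel₀ H.s₁_ne_zero this

theorem apply_s₂_of_neg {g : L ≃ₐ[K] L} (hg : g s₁ = -s₁) : g s₂ = -s₂ := by
  have := H.apply_mul g
  rw [hg] at this
  exact mul_left_cancel₀ H.s₁_ne_zero (by linear_combination -this)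

theorem apply_s_of_fix {g : L ≃ₐ[K] L} (hg : g s₁ = s₁) : g s = s ∨ g s = -s :=
  sq_eq_sq_iff_eq_or_eq_neg.mp (by
    rw [← map_pow, H.sq, map_mul, map_add, map_mul, hg, map_intCast, map_intCast, map_intCast])

theorem eq_one_of_fix {g : L ≃ₐ[K] L} (h₁ : g s₁ = s₁) (hs : g s = s) : g = 1 := by
  ext a
  have ha : a ∈ IntermediateField.adjoin K {s₁, s₂, s} := by
    rw [H.adjoin_eq_top]; trivial
  have h₂ := H.apply_s₂_of_fix h₁
  induction ha using IntermediateField.adjoin_induction with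
  | mem a ha => rcases ha with rfl | rfl | rfl <;> assumption
  | algebraMap k => exact g.commutes k
  | add a b _ _ ha hb => simpa using congrArg₂ (· + ·) ha hb
  | inv a _ ha => simpa using congrArg (·⁻¹) ha
  | mul a b _ _ ha hb => simpa using congrArg₂ (· * ·) ha hb

variable [CharZero L]

theorem sol_cast : (x : L) ^ 2 - d₁ * y ^ 2 - d₂ * z ^ 2 = 0 := by
  exact_mod_cast congrArg (Int.cast (R := L)) H.sol

theorem s₂_ne_zero : s₂ ≠ 0 := by
  intro h
  have := H.sq₂
  rw [h, zero_pow two_ne_zero] at this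
  exact H.ne_zero₂ (by exact_mod_cast this.symm)

theorem t_ne_zero : (t : L) ≠ 0 := by exact_mod_cast H.twist_ne_zero

theorem z_ne_zero : (z : L) ≠ 0 := by exact_mod_cast H.ne_zero

theorem sq_mul_conj : s ^ 2 * (t * (x - y * s₁)) = (t * z * s₂) ^ 2 := by
  rw [H.sq]
  linear_combination t ^ 2 * H.sol_cast - t ^ 2 * y ^ 2 * H.sq₁ - t ^ 2 * z ^ 2 * H.sq₂

theorem s_ne_zero : s ≠ 0 := by
  intro h
  have := H.sq_mul_conj
  rw [h, zero_pow two_ne_zero, zero_mul] at this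
  exact pow_ne_zero 2 (mul_ne_zero (mul_ne_zero H.t_ne_zero H.z_ne_zero) H.s₂_ne_zero) this.symm

theorem conj_sq : (t * z * s₂ / s) ^ 2 = t * (x - y * s₁) := by
  rw [div_pow, div_eq_iff (pow_ne_zero 2 H.s_ne_zero), ← H.sq_mul_conj, mul_comm]

theorem isGalois [CharZero K] : IsGalois K L := by
  classical
  let X : Polynomial K := Polynomial.X
  let p : Polynomial K := (X ^ 2 - (d₁ : Polynomial K)) * ((X ^ 2 - (d₂ : Polynomial K)) *
    ((X ^ 2 - (t * x : Polynomial K)) ^ 2 - (t ^ 2 * y ^ 2 * d₁ : Polynomial K)))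
  -- The roots are ±s₁, ±s₂, ±s and ±s', where s' = tzs₂/s.
  have hp : p.map (algebraMap K L) =
      ((Polynomial.X - Polynomial.C s₁) * (Polynomial.X + Polynomial.C s₁)) *
      (((Polynomial.X - Polynomial.C s₂) * (Polynomial.X + Polynomial.C s₂)) *
      (((Polynomial.X - Polynomial.C s) * (Polynomial.X + Polynomial.C s)) *
      ((Polynomial.X - Polynomial.C (t * z * s₂ / s)) *
        (Polynomial.X + Polynomial.C (t * z * s₂ / s))))) := by
    have h₁ := congrArg Polynomial.C H.sq₁
    have h₂ := congrArg Polynomial.C H.sq₂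
    have h₃ := congrArg Polynomial.C H.sq
    have h₄ := congrArg Polynomial.C H.conj_sq
    generalize t * z * s₂ / s = s' at h₄ ⊢
    simp only [Polynomial.C_pow, Polynomial.C_mul, Polynomial.C_add, Polynomial.C_sub,
      map_intCast] at h₁ h₂ h₃ h₄
    have e (a b : Polynomial L) : (a - b) * (a + b) = a ^ 2 - b ^ 2 := by ring
    simp only [e, h₁, h₂, h₃, h₄]
    simp only [p, X, Polynomial.map_mul, Polynomial.map_sub, Polynomial.map_pow,
      Polynomial.map_X, Polynomial.map_intCast]
    congr 2
    linear_combination (t ^ 2 * y ^ 2 : Polynomial L) * h₁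
  have hlin (a : L) : Polynomial.Splits (Polynomial.X - Polynomial.C a) :=
    Polynomial.Splits.X_sub_C a
  have hlin' (a : L) : Polynomial.Splits (Polynomial.X + Polynomial.C a) :=
    Polynomial.Splits.X_add_C a
  have hsplits : (p.map (algebraMap K L)).Splits := by
    rw [hp]
    exact ((hlin _).mul (hlin' _)).mul (((hlin _).mul (hlin' _)).mul
      (((hlin _).mul (hlin' _)).mul ((hlin _).mul (hlin' _))))
  have hne : p.map (algebraMap K L) ≠ 0 := by
    rw [hp]
    simp only [mul_ne_zero_iff]
    exact ⟨⟨Polynomial.X_sub_C_ne_zero _, Polynomial.X_add_C_ne_zero _⟩,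
      ⟨Polynomial.X_sub_C_ne_zero _, Polynomial.X_add_C_ne_zero _⟩,
      ⟨Polynomial.X_sub_C_ne_zero _, Polynomial.X_add_C_ne_zero _⟩,
      ⟨Polynomial.X_sub_C_ne_zero _, Polynomial.X_add_C_ne_zero _⟩⟩
  have : p.IsSplittingField K L := by
    rw [isSplittingField_iff_intermediateField]
    refine ⟨hsplits, top_le_iff.mp ?_⟩
    rw [← H.adjoin_eq_top]
    refine IntermediateField.adjoin.mono _ _ _ ?_
    rintro a ha
    rw [Polynomial.rootSet, Finset.mem_coe, Multiset.mem_toFinset, Polynomial.aroots,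
      Polynomial.mem_roots hne, hp, Polynomial.IsRoot]
    simp only [Polynomial.eval_mul, Polynomial.eval_sub, Polynomial.eval_add, Polynomial.eval_X,
      Polynomial.eval_C]
    rcases ha with rfl | rfl | rfl <;> simp
  have := Normal.of_isSplittingField (F := K) (E := L) p
  exact { }

/-- Here g(s)·s = ±tzs₂; applying g negates the right side, so g(g(s))·g(s) = -g(s)·s. -/
theorem apply_apply_s_of_neg {g : L ≃ₐ[K] L} (hg : g s₁ = -s₁) : g (g s) = -s := by
  have hgs : g s ≠ 0 := (map_ne_zero_iff g g.injective).mpr H.s_ne_zero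
  have hsq : (g s * s) ^ 2 = (t * z * s₂) ^ 2 := by
    rw [← H.sq_mul_conj, mul_pow, ← map_pow, H.sq, map_mul, map_add, map_mul, hg, map_intCast,
      map_intCast, map_intCast]
    ring
  have h₂ := H.apply_s₂_of_neg hg
  rcases sq_eq_sq_iff_eq_or_eq_neg.mp hsq with h | h
  · have h' := congrArg g h
    rw [map_mul, map_mul, map_mul, h₂, map_intCast, map_intCast] at h'
    exact mul_right_cancel₀ hgs (by linear_combination h' + h)
  · have h' := congrArg g h
    rw [map_neg, map_mul, map_mul, map_mul, h₂, map_intCast, map_intCast] at h'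
    exact mul_right_cancel₀ hgs (by linear_combination h' + h)

/-- The only involution fixes `s₁` and `s₂` and changes the sign of `s`. -/
theorem apply_of_mul_self {g : L ≃ₐ[K] L} (hg : g ≠ 1) (hgg : g * g = 1) : g s₁ = s₁ ∧ g s₂ = s₂ ∧ g s = -s := by
  have hgg' (a : L) : g (g a) = a := by rw [← AlgEquiv.mul_apply, hgg]; rfl
  rcases H.apply_s₁ g with h | h
  · refine ⟨h, H.apply_s₂_of_fix h, (H.apply_s_of_fix h).resolve_left fun h' ↦ ?_⟩
    exact hg (H.eq_one_of_fix h h')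
  · have := H.apply_apply_s_of_neg h
    rw [hgg', self_eq_neg] at this
    exact absurd this H.s_ne_zero

theorem isCyclicQuartic [CharZero K] [FiniteDimensional K L] : IsCyclicQuartic K L := by
  have hgal := H.isGalois
  obtain ⟨τ, hτ⟩ : ∃ τ : L ≃ₐ[K] L, τ s₁ ≠ s₁ := by
    by_contra! hall
    obtain ⟨k, hk⟩ := (IsGalois.mem_range_algebraMap_iff_fixed (F := K) s₁).mpr hall
    exact H.notMem k hk
  have hτ₁ := (H.apply_s₁ τ).resolve_left hτ
  have hττ := H.apply_apply_s_of_neg hτ₁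
  have hττ₁ : τ (τ s₁) = s₁ := by rw [hτ₁, map_neg, hτ₁, neg_neg]
  have hfix (g : L ≃ₐ[K] L) (hg : g s₁ = s₁) : g = 1 ∨ g = τ * τ := by
    rcases H.apply_s_of_fix hg with h | h
    · exact Or.inl (H.eq_one_of_fix hg h)
    · right
      have : (τ * τ) * g = 1 := by
        refine H.eq_one_of_fix ?_ ?_
        · simp only [AlgEquiv.mul_apply, hg, hττ₁]
        · simp only [AlgEquiv.mul_apply, h, map_neg, hττ, neg_neg]
      have h4 : (τ * τ) * (τ * τ) = 1 := by
        refine H.eq_one_of_fix ?_ ?_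
        · simp only [AlgEquiv.mul_apply, hττ₁]
        · simp only [AlgEquiv.mul_apply, hττ, map_neg, neg_neg]
      exact mul_left_cancel (this.trans h4.symm)
  have hττne : τ ^ 2 ≠ 1 := by
    intro h
    have : τ (τ s) = s := by rw [← AlgEquiv.mul_apply, ← pow_two, h]; rfl
    rw [hττ, neg_eq_self] at this
    exact H.s_ne_zero this
  have h4 : τ ^ 4 = 1 := by
    refine H.eq_one_of_fix ?_ ?_ <;>
      simp only [pow_succ, pow_zero, one_mul, AlgEquiv.mul_apply, hττ₁, hττ, map_neg, neg_neg]
  have horder : orderOf τ = 4 := orderOf_eq_prime_pow (p := 2) (n := 1) (by simpa using hττne) h4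
  have hgen (g : L ≃ₐ[K] L) : g ∈ Subgroup.zpowers τ := by
    have key (g : L ≃ₐ[K] L) (hg : g s₁ = s₁) : g ∈ Subgroup.zpowers τ := by
      rcases hfix g hg with rfl | rfl
      · exact one_mem _
      · exact mul_mem (Subgroup.mem_zpowers τ) (Subgroup.mem_zpowers τ)
    -- Either g or gτ fixes s₁, and only 1 and τ² do so.
    rcases H.apply_s₁ g with h | h
    · exact key g h
    · have := key (g * τ) (by rw [AlgEquiv.mul_apply, hτ₁, map_neg, h, neg_neg])
      exact (Subgroup.mul_mem_cancel_right _ (Subgroup.mem_zpowers τ)).mp this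
  exact
    { isGalois := hgal
      isCyclic := ⟨τ, hgen⟩
      finrank_eq := by
        rw [← IsGalois.card_aut_eq_finrank, ← orderOf_eq_card_of_forall_mem_zpowers hgen, horder] }

end

end IsRedeiExtension

/-! ### Unramifiedness at all finite primes -/

theorem exists_sub_notMem_of_isTwoAdicTwist {R : Type*} [CommRing R] [IsDomain R] [CharZero R]
    [IsIntegrallyClosed R] (c : R →+* R) (P : Ideal R) [P.IsPrime] {p : ℕ}
    (hp : ∀ n : ℤ, (n : R) ∈ P ↔ (p : ℤ) ∣ n) (hpp : p.Prime) {d x y t : ℤ} {S₁ S S' : R}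
    (hS₁ : S₁ ^ 2 = d) (hS : S ^ 2 = t * (x + y * S₁)) (hS' : S' ^ 2 = t * (x - y * S₁))
    (hc₁ : c S₁ = S₁) (hc : c S = -S) (hc' : c S' = -S') (ht : t ∣ 2)
    (hodd : p ≠ 2 → (p : ℤ) ∣ x → ¬ (p : ℤ) ∣ y ^ 2 * d) (htwo : IsTwoAdicTwist d x y t) :
    ∃ a, c a - a ∉ P := by
  by_cases h2 : p = 2
  · subst h2
    have h2P : (2 : R) ∈ P := by exact_mod_cast (hp 2).mpr dvd_rfl
    rcases htwo with ⟨k, f, g, rfl, hd, hg⟩ | ⟨r, h, g, j, hr, hd, hg⟩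
    · exact exists_sub_notMem_of_sq_eq_one_add c P h2P hS₁ (x := x) (y := k) (t := t)
        (by rw [hS]; push_cast; ring) hc hd hg
    · exact exists_sub_notMem_of_sq_eq_four_pow c P h2P hS₁ hS hS' hc₁ hc hc' hr hd hg
  have h2P : (2 : R) ∉ P := by
    intro h
    have h' : (p : ℤ) ∣ 2 := (hp 2).mp (by exact_mod_cast h)
    exact h2 ((Nat.prime_dvd_prime_iff_eq hpp Nat.prime_two).mp (by exact_mod_cast h'))
  have htP : (t : R) ∉ P := by
    intro h
    obtain ⟨k, hk⟩ := ht
    have : (2 : R) = t * k := by exact_mod_cast congrArg (Int.cast (R := R)) hk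
    exact h2P (this ▸ P.mul_mem_right _ h)
  have key (a : R) (ha : c a = -a) (haP : a ∉ P) : ∃ a, c a - a ∉ P := by
    refine ⟨a, fun h ↦ ?_⟩
    rw [ha, show -a - a = -(2 * a) by ring, neg_mem_iff] at h
    exact (Ideal.IsPrime.mem_or_mem inferInstance h).elim h2P haP
  -- For odd p, an element negated by c must lie in P, so S and S' both do; then so do x and yS₁.
  by_contra hall
  have hSP : S ∈ P := by_contra fun h ↦ hall (key S hc h)
  have hSP' : S' ∈ P := by_contra fun h ↦ hall (key S' hc' h)
  have hb : (x : R) + y * S₁ ∈ P := by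
    refine (Ideal.IsPrime.mem_or_mem inferInstance (?_ : (t : R) * _ ∈ P)).resolve_left htP
    rw [← hS, sq]
    exact P.mul_mem_left _ hSP
  have hb' : (x : R) - y * S₁ ∈ P := by
    refine (Ideal.IsPrime.mem_or_mem inferInstance (?_ : (t : R) * _ ∈ P)).resolve_left htP
    rw [← hS', sq]
    exact P.mul_mem_left _ hSP'
  have hx : (x : R) ∈ P := by
    refine (Ideal.IsPrime.mem_or_mem inferInstance (?_ : (2 : R) * _ ∈ P)).resolve_left h2P
    rw [show (2 : R) * x = x + y * S₁ + (x - y * S₁) by ring]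
    exact add_mem hb hb'
  have hy : (y : R) * S₁ ∈ P := by simpa using sub_mem hb hx
  refine hodd h2 ((hp x).mp hx) ((hp _).mp ?_)
  push_cast
  rw [← hS₁, show (y : R) ^ 2 * S₁ ^ 2 = y * S₁ * (y * S₁) by ring]
  exact P.mul_mem_left _ hy

theorem NumberField.RingOfIntegers.exists_prime_intCast_mem_iff {L : Type*} [Field L]
    [NumberField L] (P : Ideal (NumberField.RingOfIntegers L)) [P.IsPrime] (hP : P ≠ ⊥) :
    ∃ p : ℕ, p.Prime ∧
      ∀ n : ℤ, (n : NumberField.RingOfIntegers L) ∈ P ↔ (p : ℤ) ∣ n := by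
  have hne : P.under ℤ ≠ ⊥ := mt Ideal.eq_bot_of_comap_eq_bot hP
  obtain ⟨q, hq⟩ := (IsPrincipalIdealRing.principal (P.under ℤ)).principal
  rw [Ideal.submodule_span_eq] at hq
  have hq0 : q ≠ 0 := by
    rintro rfl
    exact hne (by rw [hq, Ideal.span_singleton_eq_bot])
  have hqp : Prime q := by
    rw [← Ideal.span_singleton_prime hq0, ← hq]
    infer_instance
  refine ⟨q.natAbs, Int.prime_iff_natAbs_prime.mp hqp, fun n ↦ ?_⟩
  rw [Int.natAbs_dvd, ← Ideal.mem_span_singleton, ← hq, Ideal.mem_comap, eq_intCast]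

theorem IsRedeiExtension.isFinitelyUnramified {K L : Type*} [Field K] [Field L] [Algebra K L]
    [NumberField K] [NumberField L] {d₁ d₂ x y z t : ℤ} {s₁ s₂ s : L}
    (H : IsRedeiExtension K d₁ d₂ x y z t s₁ s₂ s) (ht : t ∣ 2)
    (hodd : ∀ p : ℕ, p.Prime → p ≠ 2 → (p : ℤ) ∣ x → ¬ (p : ℤ) ∣ y ^ 2 * d₁)
    (htwo : IsTwoAdicTwist d₁ x y t) : IsFinitelyUnramified K L := by
  have hgal := H.isGalois
  have hcyc := H.isCyclicQuartic
  refine isFinitelyUnramified_of_inertia fun P _ hP g hg ↦ ?_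
  -- In a group of order 4, a nontrivial g or its square is an involution, and inertia is a
  -- subgroup.
  suffices hinv : ∀ c : L ≃ₐ[K] L, c ≠ 1 → c * c = 1 →
      ∃ a : NumberField.RingOfIntegers L, c • a - a ∉ P by
    by_contra! hall
    have hmem : g ∈ P.inertia (L ≃ₐ[K] L) := hall
    have h4 : g ^ 4 = 1 := by
      rw [← hcyc.finrank_eq, ← IsGalois.card_aut_eq_finrank]
      exact pow_card_eq_one'
    by_cases hgg : g * g = 1
    · obtain ⟨a, ha⟩ := hinv g hg hgg
      exact ha (hall a)
    · obtain ⟨a, ha⟩ := hinv (g * g) hgg (by simpa [pow_succ, mul_assoc] using h4)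
      exact ha (mul_mem hmem hmem a)
  intro c hc hcc
  obtain ⟨hc₁, hc₂, hcs⟩ := H.apply_of_mul_self hc hcc
  obtain ⟨p, hpp, hp⟩ := NumberField.RingOfIntegers.exists_prime_intCast_mem_iff P hP
  have hcast (n : ℤ) : IsIntegral ℤ (n : L) := isIntegral_algebraMap (R := ℤ) (x := n)
  have hint {a b : L} (hb : IsIntegral ℤ b) (h : a ^ 2 = b) : IsIntegral ℤ a :=
    IsIntegral.of_pow two_pos (h ▸ hb)
  have hi₁ : IsIntegral ℤ s₁ := hint (hcast _) H.sq₁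
  have his : IsIntegral ℤ s := hint ((hcast _).mul ((hcast _).add ((hcast _).mul hi₁))) H.sq
  have his' : IsIntegral ℤ (t * z * s₂ / s) :=
    hint ((hcast _).mul ((hcast _).sub ((hcast _).mul hi₁))) H.conj_sq
  have hext {a b : NumberField.RingOfIntegers L} (h : (a : L) = b) : a = b :=
    NumberField.RingOfIntegers.ext h
  obtain ⟨S₁, hS₁⟩ : ∃ S₁ : NumberField.RingOfIntegers L, (S₁ : L) = s₁ := ⟨⟨s₁, hi₁⟩, rfl⟩
  obtain ⟨S, hS⟩ : ∃ S : NumberField.RingOfIntegers L, (S : L) = s := ⟨⟨s, his⟩, rfl⟩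
  obtain ⟨S', hS'⟩ : ∃ S' : NumberField.RingOfIntegers L, (S' : L) = t * z * s₂ / s :=
    ⟨⟨_, his'⟩, rfl⟩
  refine exists_sub_notMem_of_isTwoAdicTwist
    (MulSemiringAction.toRingHom (L ≃ₐ[K] L) (NumberField.RingOfIntegers L) c) P hp hpp
    (d := d₁) (x := x) (y := y) (t := t) (S₁ := S₁) (S := S) (S' := S')
    (hext ?_) (hext ?_) (hext ?_) (hext ?_) (hext ?_) (hext ?_) ht (hodd p hpp) htwo
  · simpa [hS₁] using H.sq₁
  · simpa [hS₁, hS] using H.sq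
  · simpa [hS₁, hS'] using H.conj_sq
  · change c (S₁ : L) = S₁
    rw [hS₁, hc₁]
  · change c (S : L) = -(S : L)
    rw [hS, hcs]
  · change c (S' : L) = -(S' : L)
    rw [hS', map_div₀, map_mul, map_mul, hc₂, hcs, map_intCast, map_intCast, div_neg]

/-! ### Realization inside ℂ -/

theorem exists_add_mul_of_mem_adjoin_of_sq {s w : ℂ} {q : ℚ} (hs : s ^ 2 = q)
    (hw : w ∈ IntermediateField.adjoin ℚ {s}) : ∃ a b : ℚ, w = a + b * s := by
  have hint : IsIntegral ℚ s :=
    IsIntegral.of_pow two_pos (hs ▸ isIntegral_algebraMap (R := ℚ) (A := ℂ) (x := q))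
  rw [← IntermediateField.mem_toSubalgebra,
    IntermediateField.adjoin_simple_toSubalgebra_of_isAlgebraic hint.isAlgebraic] at hw
  induction hw using Algebra.adjoin_induction with
  | mem a ha =>
    rw [Set.mem_singleton_iff] at ha
    exact ⟨0, 1, by rw [ha]; simp⟩
  | algebraMap r => exact ⟨r, 0, by simp⟩
  | add a b _ _ ha hb =>
    obtain ⟨a₁, a₂, rfl⟩ := ha
    obtain ⟨b₁, b₂, rfl⟩ := hb
    exact ⟨a₁ + b₁, a₂ + b₂, by push_cast; ring⟩
  | mul a b _ _ ha hb =>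
    obtain ⟨a₁, a₂, rfl⟩ := ha
    obtain ⟨b₁, b₂, rfl⟩ := hb
    exact ⟨a₁ * b₁ + a₂ * b₂ * q, a₁ * b₂ + a₂ * b₁, by
      push_cast; linear_combination a₂ * b₂ * hs⟩

namespace SatisfiesRedeiConditions

variable {D d₁ d₂ : ℤ}

/-- Squaring s₁ = a + b√D makes d₂ (a = 0), d₁ (b = 0) or D (ab ≠ 0) a rational square. -/
theorem notMem_adjoin (h : SatisfiesRedeiConditions D d₁ d₂) {sD s₁ : ℂ} (hsD : sD ^ 2 = D)
    (hs₁ : s₁ ^ 2 = d₁) : s₁ ∉ IntermediateField.adjoin ℚ {sD} := by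
  intro hmem
  obtain ⟨a, b, hab⟩ := exists_add_mul_of_mem_adjoin_of_sq (q := D) (by simpa using hsD) hmem
  have hsq : (a : ℂ) ^ 2 + b ^ 2 * D + 2 * a * b * sD = d₁ := by
    rw [← hs₁, hab]
    linear_combination -(b : ℂ) ^ 2 * hsD
  by_cases ha : a = 0
  · subst ha
    have h1 : b ^ 2 * (d₁ * d₂ : ℤ) = (d₁ : ℚ) := by
      rw [h.eq_mul] at hsq
      have : (b : ℂ) ^ 2 * (d₁ * d₂ : ℤ) = d₁ := by
        rw [← hsq]; push_cast; ring
      exact_mod_cast this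
    have hd₁ : (d₁ : ℚ) ≠ 0 := by exact_mod_cast h.isDiscr₁.ne_zero
    push_cast at h1
    have h2 : b ^ 2 * d₂ = 1 := mul_left_cancel₀ hd₁ (by linear_combination h1)
    have hb : b ≠ 0 := by rintro rfl; norm_num at h2
    refine h.isDiscr₂.sq_ne_ratCast b⁻¹ ?_
    field_simp
    linear_combination -h2
  by_cases hb : b = 0
  · subst hb
    refine h.isDiscr₁.sq_ne_ratCast a ?_
    have : (a : ℂ) ^ 2 = d₁ := by rw [← hsq]; push_cast; ring
    exact_mod_cast this
  refine h.isDiscr.sq_ne_ratCast ((d₁ - a ^ 2 - b ^ 2 * D) / (2 * a * b)) ?_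
  have ha' : (a : ℂ) ≠ 0 := by exact_mod_cast ha
  have hb' : (b : ℂ) ≠ 0 := by exact_mod_cast hb
  have hsD' : sD = (((d₁ - a ^ 2 - b ^ 2 * D) / (2 * a * b) : ℚ) : ℂ) := by
    push_cast
    rw [eq_div_iff (by simp [ha', hb'])]
    linear_combination hsq
  rw [hsD'] at hsD
  exact_mod_cast hsD

theorem exists_le_and_isFinitelyUnramified (h : SatisfiesRedeiConditions D d₁ d₂) {x y z t : ℤ}
    (hprim : Int.gcd (Int.gcd x y) z = 1) (hsol : x ^ 2 - d₁ * y ^ 2 - d₂ * z ^ 2 = 0)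
    (ht : t ∣ 2) (htwo : IsTwoAdicTwist d₁ x y t) {sD s₁ s₂ s : ℂ} (hsD : sD ^ 2 = D)
    (hs₁ : s₁ ^ 2 = d₁) (hs₂ : s₂ ^ 2 = d₂) (hs : s ^ 2 = t * (x + y * s₁)) :
    ∃ h : IntermediateField.adjoin ℚ {sD} ≤ IntermediateField.adjoin ℚ {s₁, s₂, s},
      IsFinitelyUnramified (IntermediateField.adjoin ℚ {sD})
        (IntermediateField.extendScalars h) ∧
      IsCyclicQuartic (IntermediateField.adjoin ℚ {sD})
        (IntermediateField.extendScalars h) := by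
  have hm₁ : s₁ ∈ IntermediateField.adjoin ℚ {s₁, s₂, s} :=
    IntermediateField.subset_adjoin _ _ (by simp)
  have hm₂ : s₂ ∈ IntermediateField.adjoin ℚ {s₁, s₂, s} :=
    IntermediateField.subset_adjoin _ _ (by simp)
  have hm : s ∈ IntermediateField.adjoin ℚ {s₁, s₂, s} :=
    IntermediateField.subset_adjoin _ _ (by simp)
  -- The square roots are arbitrary, so s₁s₂ is √D only up to sign.
  have hprod : s₁ * s₂ = sD ∨ s₁ * s₂ = -sD := sq_eq_sq_iff_eq_or_eq_neg.mp (by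
    rw [mul_pow, hs₁, hs₂, hsD, h.eq_mul]; push_cast; rfl)
  have hle : IntermediateField.adjoin ℚ {sD} ≤ IntermediateField.adjoin ℚ {s₁, s₂, s} := by
    rw [IntermediateField.adjoin_simple_le_iff]
    rcases hprod with h | h
    · exact h ▸ mul_mem hm₁ hm₂
    · rw [← neg_neg sD, ← h]
      exact neg_mem (mul_mem hm₁ hm₂)
  have hcast (n : ℤ) : IsIntegral ℚ (n : ℂ) := by
    simpa using isIntegral_algebraMap (R := ℚ) (A := ℂ) (x := (n : ℚ))
  have hint {a b : ℂ} (hb : IsIntegral ℚ b) (h : a ^ 2 = b) : IsIntegral ℚ a :=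
    IsIntegral.of_pow two_pos (h ▸ hb)
  have hi₁ : IsIntegral ℚ s₁ := hint (hcast _) hs₁
  have hi₂ : IsIntegral ℚ s₂ := hint (hcast _) hs₂
  have hi : IsIntegral ℚ s := hint ((hcast _).mul ((hcast _).add ((hcast _).mul hi₁))) hs
  have hfinK : FiniteDimensional ℚ (IntermediateField.adjoin ℚ {sD}) :=
    IntermediateField.adjoin.finiteDimensional (hint (hcast _) hsD)
  have hnfK : NumberField (IntermediateField.adjoin ℚ {sD}) := { to_finiteDimensional := hfinK }
  have hfin : FiniteDimensional (IntermediateField.adjoin ℚ {sD})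
      (IntermediateField.extendScalars hle) := by
    rw [IntermediateField.extendScalars_adjoin]
    have : Finite ({s₁, s₂, s} : Set ℂ) := (Set.toFinite _).to_subtype
    refine IntermediateField.finiteDimensional_adjoin ?_
    rintro a (rfl | rfl | rfl)
    exacts [hi₁.tower_top, hi₂.tower_top, hi.tower_top]
  have hnf : NumberField (IntermediateField.extendScalars hle) :=
    NumberField.of_module_finite (IntermediateField.adjoin ℚ {sD}) _
  have H : IsRedeiExtension (L := IntermediateField.extendScalars hle)
      (IntermediateField.adjoin ℚ {sD}) d₁ d₂ x y z t ⟨s₁, hm₁⟩ ⟨s₂, hm₂⟩ ⟨s, hm⟩ :=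
    { sq₁ := Subtype.ext (by simpa using hs₁)
      sq₂ := Subtype.ext (by simpa using hs₂)
      sq := Subtype.ext (by simpa using hs)
      exists_mul := by
        have hmD := IntermediateField.mem_adjoin_simple_self ℚ sD
        rcases hprod with h | h
        · exact ⟨⟨sD, hmD⟩, Subtype.ext h.symm⟩
        · exact ⟨⟨-sD, neg_mem hmD⟩, Subtype.ext h.symm⟩
      notMem := by
        rintro ⟨k, hk⟩ hks
        have hks' : k = s₁ := congrArg Subtype.val hks
        exact h.notMem_adjoin hsD hs₁ (hks' ▸ hk)
      adjoin_eq_top := by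
        rw [← IntermediateField.lift_inj, IntermediateField.lift_adjoin,
          IntermediateField.lift_top]
        refine Eq.trans (congrArg _ ?_) (IntermediateField.extendScalars_adjoin hle).symm
        rw [Set.image_insert_eq, Set.image_insert_eq, Set.image_singleton]
      sol := hsol
      twist_ne_zero := by rintro rfl; norm_num at ht
      ne_zero := h.ne_zero_of_sol hprim hsol
      ne_zero₂ := h.isDiscr₂.ne_zero }
  exact ⟨hle, H.isFinitelyUnramified ht
    (fun p hp hp2 hx ↦ h.not_dvd_of_dvd_sq_mul hprim hsol hp hp2 hx) htwo, H.isCyclicQuartic⟩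

end SatisfiesRedeiConditions

/-! ### Exchanging d₁ and d₂ -/

/-- `ℚ(√d₁, √d₂, √β) = ℚ(√d₁, √d₂, √(2α))` for `β = t (x + y √d₁)` and `α = t (x + z √d₂)`. -/
theorem exists_sq_eq_and_adjoin_eq {d₁ d₂ x y z t t' : ℤ} {f : ℚ} (hf : f ≠ 0)
    (ht : t' = 2 * f ^ 2 * t)
    (hsol : x ^ 2 - d₁ * y ^ 2 - d₂ * z ^ 2 = 0) {s₁ s₂ s : ℂ}
    (hs₁ : s₁ ^ 2 = d₁) (hs₂ : s₂ ^ 2 = d₂) (hs : s ^ 2 = t * (x + y * s₁))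
    (hβ : (x : ℂ) + y * s₁ ≠ 0) (hα : (x : ℂ) + z * s₂ ≠ 0) :
    ∃ s' : ℂ, s' ^ 2 = t' * (x + z * s₂) ∧
      IntermediateField.adjoin ℚ {s₂, s₁, s'} = IntermediateField.adjoin ℚ {s₁, s₂, s} := by
  have hsol' : (x : ℂ) ^ 2 - d₁ * y ^ 2 - d₂ * z ^ 2 = 0 := by
    exact_mod_cast congrArg (Int.cast (R := ℂ)) hsol
  have hf' : (f : ℂ) ≠ 0 := by exact_mod_cast hf
  have ht' : (t' : ℂ) = 2 * f ^ 2 * t := by exact_mod_cast congrArg (Rat.cast (K := ℂ)) ht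
  set w : ℂ := x + y * s₁ + z * s₂ with hw
  have hw2 : w ^ 2 = 2 * (x + y * s₁) * (x + z * s₂) := by
    rw [hw]
    linear_combination (y : ℂ) ^ 2 * hs₁ + z ^ 2 * hs₂ - hsol'
  have hw0 : w ≠ 0 := by
    intro h0
    rw [h0, zero_pow two_ne_zero] at hw2
    exact mul_ne_zero (mul_ne_zero two_ne_zero hβ) hα hw2.symm
  have hmw (F : IntermediateField ℚ ℂ) (h₁ : s₁ ∈ F) (h₂ : s₂ ∈ F) :
      f * w / (x + y * s₁) ∈ F := by
    have hr (q : ℚ) : (q : ℂ) ∈ F := F.algebraMap_mem q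
    exact div_mem (mul_mem (hr f) (add_mem (add_mem (intCast_mem _ _)
      (mul_mem (intCast_mem _ _) h₁)) (mul_mem (intCast_mem _ _) h₂)))
      (add_mem (intCast_mem _ _) (mul_mem (intCast_mem _ _) h₁))
  have hne : f * w / (x + y * s₁) ≠ 0 := div_ne_zero (mul_ne_zero hf' hw0) hβ
  refine ⟨s * (f * w / (x + y * s₁)), ?_, le_antisymm ?_ ?_⟩
  · rw [mul_pow, hs, div_pow, mul_pow, hw2, ht']
    field_simp
  · rw [IntermediateField.adjoin_le_iff]
    have hm₁ : s₁ ∈ IntermediateField.adjoin ℚ {s₁, s₂, s} :=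
      IntermediateField.subset_adjoin _ _ (by simp)
    have hm₂ : s₂ ∈ IntermediateField.adjoin ℚ {s₁, s₂, s} :=
      IntermediateField.subset_adjoin _ _ (by simp)
    rintro a (rfl | rfl | rfl)
    · exact hm₂
    · exact hm₁
    · exact mul_mem (IntermediateField.subset_adjoin _ _ (by simp)) (hmw _ hm₁ hm₂)
  · rw [IntermediateField.adjoin_le_iff]
    generalize hc : f * w / (x + y * s₁) = c at *
    have hm₁ : s₁ ∈ IntermediateField.adjoin ℚ {s₂, s₁, s * c} :=
      IntermediateField.subset_adjoin _ _ (by simp)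
    have hm₂ : s₂ ∈ IntermediateField.adjoin ℚ {s₂, s₁, s * c} :=
      IntermediateField.subset_adjoin _ _ (by simp)
    rintro a (rfl | rfl | rfl)
    · exact hm₁
    · exact hm₂
    · have := div_mem (IntermediateField.subset_adjoin ℚ {s₂, s₁, a * c} (by simp : a * c ∈ _))
        (hmw _ hm₁ hm₂)
      rwa [mul_div_cancel_right₀ _ hne] at this

theorem SatisfiesRedeiConditions.add_mul_ne_zero {D d₁ d₂ : ℤ}
    (h : SatisfiesRedeiConditions D d₁ d₂) {x y z : ℤ}
    (hprim : Int.gcd (Int.gcd x y) z = 1) (hsol : x ^ 2 - d₁ * y ^ 2 - d₂ * z ^ 2 = 0)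
    {s₁ : ℂ} (hs₁ : s₁ ^ 2 = d₁) : (x : ℂ) + y * s₁ ≠ 0 := by
  intro h0
  have hsol' : (x : ℂ) ^ 2 - d₁ * y ^ 2 - d₂ * z ^ 2 = 0 := by
    exact_mod_cast congrArg (Int.cast (R := ℂ)) hsol
  have : (d₂ : ℂ) * z ^ 2 = 0 := by
    linear_combination (x - y * s₁) * h0 + (y : ℂ) ^ 2 * hs₁ - hsol'
  have h' : d₂ * z ^ 2 = 0 := by exact_mod_cast this
  exact mul_ne_zero h.isDiscr₂.ne_zero (pow_ne_zero 2 (h.ne_zero_of_sol hprim hsol)) h'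

theorem mainTheorem7 (D d₁ d₂ : ℤ) (hD : SatisfiesRedeiConditions D d₁ d₂)
    (x y z : ℤ) (hprim : Int.gcd (Int.gcd x y) z = 1)
    (hsol : x ^ 2 - d₁ * y ^ 2 - d₂ * z ^ 2 = 0) :
    ∃ t : ℤ, t ∈ ({1, -1, 2, -2} : Set ℤ) ∧
      ∀ sD s₁ s₂ s : ℂ, sD ^ 2 = (D : ℂ) → s₁ ^ 2 = (d₁ : ℂ) → s₂ ^ 2 = (d₂ : ℂ) →
        s ^ 2 = (t : ℂ) * x + (t : ℂ) * y * s₁ →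
        ∃ h : IntermediateField.adjoin ℚ {sD} ≤ IntermediateField.adjoin ℚ {s₁, s₂, s},
          IsFinitelyUnramified (IntermediateField.adjoin ℚ {sD})
            (IntermediateField.extendScalars h) ∧
          IsCyclicQuartic (IntermediateField.adjoin ℚ {sD})
            (IntermediateField.extendScalars h) := by
  have hdvd {t : ℤ} (ht : t ∈ ({1, -1, 2, -2} : Set ℤ)) : t ∣ 2 := by
    rcases ht with rfl | rfl | rfl | rfl <;> norm_num
  obtain ⟨t, ht, htwo | htwo⟩ := hD.exists_isTwoAdicTwist hprim hsol
  · refine ⟨t, ht, fun sD s₁ s₂ s hsD hs₁ hs₂ hs ↦ ?_⟩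
    exact hD.exists_le_and_isFinitelyUnramified hprim hsol (hdvd ht) htwo hsD hs₁ hs₂
      (by rw [hs]; ring)
  · have hprim' : Int.gcd (Int.gcd x z) y = 1 := by
      rw [Int.gcd_assoc, Int.gcd_comm z y, ← Int.gcd_assoc]; exact hprim
    have hsol' : x ^ 2 - d₂ * z ^ 2 - d₁ * y ^ 2 = 0 := by linarith
    -- The exchange doubles the twist modulo squares, which permutes {±1, ±2}: e is chosen so that
    -- 2e is t up to the square f².
    obtain ⟨e, f, he, hf, hef⟩ : ∃ (e : ℤ) (f : ℚ), e ∈ ({1, -1, 2, -2} : Set ℤ) ∧ f ≠ 0 ∧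
        t = 2 * f ^ 2 * e := by
      rcases ht with rfl | rfl | rfl | rfl
      · exact ⟨2, 1 / 2, by norm_num⟩
      · exact ⟨-2, 1 / 2, by norm_num⟩
      · exact ⟨1, 1, by norm_num⟩
      · exact ⟨-1, 1, by norm_num⟩
    refine ⟨e, he, fun sD s₁ s₂ s hsD hs₁ hs₂ hs ↦ ?_⟩
    obtain ⟨s', hs', heq⟩ := exists_sq_eq_and_adjoin_eq hf hef hsol hs₁ hs₂
      (by rw [hs]; ring) (hD.add_mul_ne_zero hprim hsol hs₁)
      (hD.symm.add_mul_ne_zero hprim' hsol' hs₂)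
    rw [← heq]
    exact hD.symm.exists_le_and_isFinitelyUnramified hprim' hsol' (hdvd ht) htwo hsD hs₂ hs₁ hs'
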